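/- For a finite, simple, undirected, unweighted graph $G=(V,E)$ let $d_G$ denote the hop distance in $G$ (with $d_G(u,v)=\infty$ if $u,v$ are not connected), and let $n=|V|$. For a real $t\ge 1$, a subgraph $H=(V,E')$ of $G$ is a $t$-spanner of $G$ if $d_H(u,v)\le t\cdot d_G(u,v)$ for all $u,v\in V$. An edge $\{u,v\}\in E$ is $t$-unspanned with respect to $H$ if $d_H(u,v)>t$. The parallel greedy algorithm on input $(G,t)$ starts with $H=(V,\emptyset)$. As long as some edge of $G$ is $t$-unspanned with respect to the current $H$, it chooses an arbitrary nonempty matching $M\subseteq E$ (a set of pairwise disjoint edges), each edge of which is $t$-unspanned with respect to the current $H$, and adds all edges of $M$ to $H$. When no edge of $G$ is $t$-unspanned with respect to $H$, it outputs $H$. Theorem. There is a universal constant $C>0$ such that for every finite simple graph $G$ on $n$ vertices and every real $t\ge 1$, no matter which matchings are chosen, the parallel greedy algorithm on $(G,t)$ terminates (it never runs forever, and whenever some edge is $t$-unspanned an admissible matching exists), and every graph $H$ that it outputs is a $t$-spanner of $G$ with at most $$t^3\cdot \log^3 n\cdot n^{1+C/t}$$ edges, where $\log$ is the natural logarithm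 (for $n\le 1$ the graph has no edges and the bound is read as $0$). -/

import Mathlib

open scoped ENNReal

namespace ParallelGreedy

/-- `d_H(u,v) > t`, where `d_H` is the hop distance in `H` (infinite if `u` and `v` are not
connected in `H`). An edge `{u,v}` of the input graph with this property is `t`-unspanned
with respect to `H`. -/
def Unspanned {V : Type*} (t : ℝ) (H : SimpleGraph V) (u v : V) : Prop :=
  ENNReal.ofReal t < (H.edist u v : ℝ≥0∞)

/-- `H` is a `t`-spanner of `G`: a subgraph of `G` on the same vertices with
`d_H(u,v) ≤ t * d_G(u,v)` for all `u, v` (distances in `[0,∞]`). -/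
def IsSpanner {V : Type*} (t : ℝ) (G H : SimpleGraph V) : Prop :=
  H ≤ G ∧ ∀ u v : V, (H.edist u v : ℝ≥0∞) ≤ ENNReal.ofReal t * (G.edist u v : ℝ≥0∞)

/-- The condition of the while loop: some edge of `G` is `t`-unspanned with respect to `H`. -/
def LoopGuard {V : Type*} (t : ℝ) (G H : SimpleGraph V) : Prop :=
  ∃ u v : V, G.Adj u v ∧ Unspanned t H u v

/-- One iteration of the while loop turns `H` into `H'`: the loop condition holds, and the edges
of an arbitrary nonempty matching `M` of `G`, each of whose edges is `t`-unspanned with respect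
to `H`, are added to `H`. The edges of `M` are not required to be unspanned once other edges
of `M` have been added. -/
def Step {V : Type*} (t : ℝ) (G H H' : SimpleGraph V) : Prop :=
  LoopGuard t G H ∧
    ∃ M : G.Subgraph, M.IsMatching ∧ M.edgeSet.Nonempty ∧
      (∀ u v : V, M.Adj u v → Unspanned t H u v) ∧ H' = H ⊔ M.spanningCoe

/-- `H` can occur as the current graph in an execution, which starts from the empty graph. -/
def IsReachable {V : Type*} (t : ℝ) (G H : SimpleGraph V) : Prop :=
  Relation.ReflTransGen (Step t G) ⊥ H

/-- `H` is a possible output of the algorithm: some execution reaches `H` and the loop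
condition fails there. -/
def IsOutput {V : Type*} (t : ℝ) (G H : SimpleGraph V) : Prop :=
  IsReachable t G H ∧ ¬ LoopGuard t G H

end ParallelGreedy

/-!
The edge bound comes from a lazy random walk that is run alongside the algorithm.

Put `k = K + 1`, where `2 * K + 1 ≤ t`, and fix a probability `p`. One walker starts on each vertex.
When a matching is added to `H`, every walker standing on a matched vertex crosses its matching edge
with probability `p`, independently of everything else; after every `k`-th move the walker is reset,
that is, its current position becomes its new starting point. The quantity of interest is `w j u v`,
the expected number of walkers at `v` which started at `u` and have made `j < k` moves since then,
together with `w k u v`, the expected number of resets at `v` of walkers that started at `u`.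

Because the edges of a matching are swapped symmetrically, the expected number of walkers at each
vertex stays equal to one, so each new edge causes `2 * p` expected moves (`IsWalkMass.moves`).
On the other hand `w j u v ≤ p ^ j` throughout (`IsWalkMass.le_pow`): the value can only increase by
walkers entering `v` through an edge `{v', v}` with `w (j - 1) u v' ≠ 0`, and if also `w j u v ≠ 0`,
then `v'` and `v` were already joined via `u` by a walk of length `2 * j - 1 ≤ 2 * K + 1 ≤ t`, so that
the edge was not unspanned. Hence the expected number of resets is at most `n ^ 2 * p ^ k`, and
counting moves gives `2 * p * m ≤ n * K + k * n ^ 2 * p ^ k` for the number `m` of edges. The choice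
`p = n ^ (-1 / k)` yields `m ≤ k * n ^ (1 + 1 / k)`, which is stronger than the bound required.

Termination holds since every step strictly enlarges `H`, and an output is a spanner since it is
enough to bound the stretch of the edges of `G`.
-/

open scoped ENNReal
open Finset

namespace ParallelGreedy

variable {V : Type*}

/-! ### Termination and the spanner property -/

lemma Unspanned.not_adj {t : ℝ} (ht : 1 ≤ t) {H : SimpleGraph V} {u v : V}
    (h : Unspanned t H u v) : ¬ H.Adj u v := by
  intro hadj
  rw [Unspanned, SimpleGraph.edist_eq_one_iff_adj.2 hadj, ENat.toENNReal_one] at h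
  exact absurd h (not_lt.2 (by simpa using ht))

lemma Step.lt {t : ℝ} (ht : 1 ≤ t) {G H H' : SimpleGraph V} (h : Step t G H H') : H < H' := by
  obtain ⟨-, M, -, ⟨e, he⟩, hun, rfl⟩ := h
  induction e with
  | _ u v =>
    refine lt_of_le_not_ge le_sup_left fun hle ↦ (hun u v he).not_adj ht (hle ?_)
    exact Or.inr he

lemma Step.le_of_le {t : ℝ} {G H H' : SimpleGraph V} (h : Step t G H H') (hH : H ≤ G) :
    H' ≤ G := by
  obtain ⟨-, M, -, -, -, rfl⟩ := h
  exact sup_le hH M.spanningCoe_le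

lemma IsReachable.le {t : ℝ} {G H : SimpleGraph V} (h : IsReachable t G H) : H ≤ G := by
  induction h with
  | refl => exact bot_le
  | tail _ hs ih => exact hs.le_of_le ih

lemma not_exists_infinite_run [Finite V] {t : ℝ} (ht : 1 ≤ t) (G : SimpleGraph V) :
    ¬ ∃ F : ℕ → SimpleGraph V, F 0 = ⊥ ∧ ∀ i, Step t G (F i) (F (i + 1)) := by
  rintro ⟨F, -, hF⟩
  exact not_injective_infinite_finite F (strictMono_nat_of_lt_succ fun i ↦ (hF i).lt ht).injective

lemma LoopGuard.exists_step {t : ℝ} {G H : SimpleGraph V} (h : LoopGuard t G H) :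
    ∃ H', Step t G H H' := by
  obtain ⟨u, v, hadj, hun⟩ := id h
  refine ⟨_, h, G.subgraphOfAdj hadj, .subgraphOfAdj hadj, ⟨s(u, v), by simp⟩, ?_, rfl⟩
  intro a b hab
  rw [SimpleGraph.subgraphOfAdj_adj, Sym2.eq_iff] at hab
  rcases hab with ⟨rfl, rfl⟩ | ⟨rfl, rfl⟩
  · exact hun
  · rwa [Unspanned, SimpleGraph.edist_comm]

lemma isSpanner_of_not_loopGuard {t : ℝ} (ht : 1 ≤ t) {G H : SimpleGraph V} (hle : H ≤ G)
    (h : ¬ LoopGuard t G H) : IsSpanner t G H := by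
  refine ⟨hle, fun u v ↦ ?_⟩
  by_cases htop : G.edist u v = ⊤
  · rw [htop, ENat.toENNReal_top, ENNReal.mul_top (by simpa using by linarith)]
    exact le_top
  obtain ⟨q, hq⟩ := SimpleGraph.exists_walk_of_edist_ne_top htop
  rw [← hq]
  clear hq htop
  induction q with
  | nil => simp
  | @cons a b c hab q ih =>
    have h1 : (H.edist a b : ℝ≥0∞) ≤ ENNReal.ofReal t := by
      by_contra hlt
      exact h ⟨a, b, hab, not_le.1 hlt⟩
    calc (H.edist a c : ℝ≥0∞) ≤ ((H.edist a b + H.edist b c : ℕ∞) : ℝ≥0∞) :=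
          ENat.toENNReal_mono SimpleGraph.edist_triangle
      _ = H.edist a b + H.edist b c := ENat.toENNReal_add _ _
      _ ≤ ENNReal.ofReal t + ENNReal.ofReal t * ((q.length : ℕ∞) : ℝ≥0∞) := add_le_add h1 ih
      _ = _ := by
          rw [SimpleGraph.Walk.length_cons]
          push_cast
          ring

/-! ### The lazy walk -/

/-- The involution of the vertex set that swaps the ends of each edge of a matching. -/
lemma exists_perm_of_isMatching {G : SimpleGraph V} {M : G.Subgraph} (hM : M.IsMatching) :
    ∃ σ : Equiv.Perm V, ∀ u v, M.Adj u v ↔ σ u ≠ u ∧ σ u = v := by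
  classical
  let f : V → V := fun v ↦ if h : v ∈ M.verts then (hM h).choose else v
  have hf {u v : V} (h : M.Adj u v) : f u = v := by
    simp only [f, dif_pos h.fst_mem]
    exact ((hM h.fst_mem).choose_spec.2 v h).symm
  have hf' {u : V} (h : u ∈ M.verts) : M.Adj u (f u) := by
    simp only [f, dif_pos h]
    exact (hM h).choose_spec.1
  have hinv : Function.Involutive f := by
    intro v
    by_cases h : v ∈ M.verts
    · exact hf (SimpleGraph.Subgraph.Adj.symm (hf' h))
    · simp [f, h]
  refine ⟨hinv.toPerm, fun u v ↦ ⟨fun h ↦ ?_, ?_⟩⟩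
  · rw [Function.Involutive.coe_toPerm, hf h]
    exact ⟨(M.adj_sub h).ne', rfl⟩
  · rw [Function.Involutive.coe_toPerm]
    rintro ⟨hne, rfl⟩
    refine hf' ?_
    by_contra hu
    exact hne (dif_neg hu)

/-- The function `w` has the properties of the expected walker counts of the lazy walk with move
probability `p` and reset after `K + 1` moves, run up to the current graph `H`. For `j ≤ K`, `w j u v`
stands for the expected number of walkers at `v` that made `j` moves since their last reset, at `u`;
`w (K + 1) u v` is the expected number of resets so far at `v` of walkers coming from `u`. Values
`w j` with `j > K + 1` are irrelevant. -/
structure IsWalkMass [Fintype V] (p : ℝ) (K : ℕ) (H : SimpleGraph V) (w : ℕ → V → V → ℝ) :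
    Prop where
  nonneg : ∀ j u v, 0 ≤ w j u v
  edist_le : ∀ j u v, w j u v ≠ 0 → H.edist u v ≤ j
  le_pow : ∀ j ≤ K + 1, ∀ u v, w j u v ≤ p ^ j
  total : ∀ v, ∑ j ∈ range (K + 1), ∑ u, w j u v = 1
  moves : p * ∑ v, ((H.neighborSet v).ncard : ℝ) = ∑ v, ∑ j ∈ range (K + 2), j * ∑ u, w j u v

open Classical in
/-- The walker counts after the matching that pairs `v` with `σ v` has been offered to the walkers;
unmatched vertices are fixed points of `σ`. -/
noncomputable def stepMass [Fintype V] (p : ℝ) (K : ℕ) (σ : Equiv.Perm V) (w : ℕ → V → V → ℝ) :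
    ℕ → V → V → ℝ
  | 0, u, v => if σ v = v then w 0 u v else
      (1 - p) * w 0 u v + if u = v then p * ∑ a, w K a (σ v) else 0
  | j + 1, u, v => if σ v = v then w (j + 1) u v else
      (if j < K then 1 - p else 1) * w (j + 1) u v + if j ≤ K then p * w j u (σ v) else 0

variable [Fintype V] {p : ℝ} {K : ℕ} {σ : Equiv.Perm V} {w : ℕ → V → V → ℝ} {v : V}

lemma sum_stepMass_zero (hv : σ v ≠ v) :
    ∑ u, stepMass p K σ w 0 u v = (1 - p) * ∑ u, w 0 u v + p * ∑ u, w K u (σ v) := by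
  simp only [stepMass, hv, if_false, sum_add_distrib, ← mul_sum]
  rw [Fintype.sum_eq_single v fun u hu ↦ if_neg hu, if_pos rfl]

lemma sum_stepMass_succ (hv : σ v ≠ v) {j : ℕ} (hj : j < K) :
    ∑ u, stepMass p K σ w (j + 1) u v =
      (1 - p) * ∑ u, w (j + 1) u v + p * ∑ u, w j u (σ v) := by
  simp [stepMass, hv, sum_add_distrib, mul_sum, hj, hj.le]

lemma sum_stepMass_last (hv : σ v ≠ v) :
    ∑ u, stepMass p K σ w (K + 1) u v = ∑ u, w (K + 1) u v + p * ∑ u, w K u (σ v) := by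
  simp [stepMass, hv, sum_add_distrib, mul_sum]

lemma stepMass_of_fixed (hv : σ v = v) (j : ℕ) (u : V) : stepMass p K σ w j u v = w j u v := by
  cases j <;> simp [stepMass, hv]

lemma total_stepMass (h : ∀ v, ∑ j ∈ range (K + 1), ∑ u, w j u v = 1) (v : V) :
    ∑ j ∈ range (K + 1), ∑ u, stepMass p K σ w j u v = 1 := by
  by_cases hv : σ v = v
  · simpa only [stepMass_of_fixed hv] using h v
  have h1 := h v
  have h2 := h (σ v)
  rw [sum_range_succ'] at h1 ⊢
  rw [sum_range_succ] at h2
  rw [sum_stepMass_zero hv, sum_congr rfl fun j hj ↦ sum_stepMass_succ hv (mem_range.1 hj),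
    sum_add_distrib, ← mul_sum, ← mul_sum]
  linear_combination (1 - p) * h1 + p * h2

/-- At a matched vertex `v`, the expected number of moves since the last reset of the walkers at `v`,
plus `K + 1` for each reset that took place at `v`, is raised by `p`, up to a term which cancels in
the sum over both ends of the matching edge. -/
lemma moves_stepMass (h : ∀ v, ∑ j ∈ range (K + 1), ∑ u, w j u v = 1) (hv : σ v ≠ v) :
    ∑ j ∈ range (K + 2), (j : ℝ) * ∑ u, stepMass p K σ w j u v =
      ∑ j ∈ range (K + 2), (j : ℝ) * ∑ u, w j u v + p +
        p * (∑ j ∈ range (K + 1), (j : ℝ) * ∑ u, w j u (σ v) -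
          ∑ j ∈ range (K + 1), (j : ℝ) * ∑ u, w j u v) := by
  have h2 := h (σ v)
  rw [sum_range_succ] at h2
  rw [sum_range_succ' _ (K + 1), sum_range_succ _ K, sum_stepMass_last hv,
    sum_congr rfl fun j hj ↦ by rw [sum_stepMass_succ hv (mem_range.1 hj)],
    sum_range_succ' _ (K + 1), sum_range_succ _ K,
    sum_range_succ _ K, sum_range_succ' (fun j ↦ (j : ℝ) * ∑ u, w j u v) K]
  simp only [mul_add, sum_add_distrib, Nat.cast_add, Nat.cast_one, Nat.cast_zero, zero_mul,
    add_mul, one_mul, mul_left_comm _ p, mul_left_comm _ (1 - p), ← mul_sum]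
  linear_combination p * h2

section Step

variable {t : ℝ} {H H' : SimpleGraph V}

lemma IsWalkMass.le_one (hw : IsWalkMass p K H w) {j : ℕ} (hj : j ≤ K) (u v : V) : w j u v ≤ 1 := by
  rw [← hw.total v]
  refine (single_le_sum (f := fun a ↦ w j a v) (fun a _ ↦ hw.nonneg j a v) (mem_univ u)).trans ?_
  exact single_le_sum (f := fun i ↦ ∑ a, w i a v)
    (fun i _ ↦ sum_nonneg fun a _ ↦ hw.nonneg i a v) (mem_range.2 (by omega))

/-- If walkers from `u` can enter `v` across an unspanned edge `{v', v}` as their `(j + 1)`-st move,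
then no walker from `u` has reached `v` in exactly `j + 1` moves before: otherwise `v` and `v'`
would be at distance at most `2 * j + 1 ≤ t`, via `u`. -/
lemma IsWalkMass.eq_zero_or_eq_zero (hw : IsWalkMass p K H w) (hK : 2 * K + 1 ≤ t) {v' : V}
    (hun : Unspanned t H v v') {j : ℕ} (hj : j ≤ K) (u : V) :
    w (j + 1) u v = 0 ∨ w j u v' = 0 := by
  by_contra! hne
  have h1 := hw.edist_le _ _ _ hne.1
  have h2 := hw.edist_le _ _ _ hne.2
  rw [SimpleGraph.edist_comm] at h1
  have h3 : H.edist v v' ≤ ((2 * K + 1 : ℕ) : ℕ∞) := calc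
    H.edist v v' ≤ ((j + 1 : ℕ) : ℕ∞) + (j : ℕ∞) :=
      SimpleGraph.edist_triangle.trans (add_le_add h1 h2)
    _ ≤ _ := by exact_mod_cast (by omega : j + 1 + j ≤ 2 * K + 1)
  refine absurd hun (not_lt.2 ((ENat.toENNReal_mono h3).trans ?_))
  rw [ENat.toENNReal_coe, ← ENNReal.ofReal_natCast]
  exact ENNReal.ofReal_le_ofReal (by exact_mod_cast hK)

/-- The properties of the walker counts persist when `H` is enlarged by a matching of unspanned
edges to `H'`; the matching is given by the involution `σ`. -/
lemma IsWalkMass.stepMass (hw : IsWalkMass p K H w) (hp0 : 0 ≤ p) (hp1 : p ≤ 1)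
    (ht : 1 ≤ t) (hK : 2 * K + 1 ≤ t) (hun : ∀ v, σ v ≠ v → Unspanned t H v (σ v))
    (hH' : ∀ u v, H'.Adj u v ↔ H.Adj u v ∨ (σ u ≠ u ∧ σ u = v)) :
    IsWalkMass p K H' (stepMass p K σ w) := by
  have hq : 0 ≤ 1 - p := sub_nonneg.2 hp1
  have hle : H ≤ H' := fun u v h ↦ (hH' u v).2 (.inl h)
  refine ⟨?_, ?_, ?_, total_stepMass hw.total, ?_⟩
  · intro j u v
    have hn := hw.nonneg
    have hs : 0 ≤ ∑ a, w K a (σ v) := sum_nonneg fun a _ ↦ hn K a _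
    cases j with
    | zero =>
      have := hn 0 u v
      simp only [ParallelGreedy.stepMass]
      split_ifs <;> positivity
    | succ j =>
      have := hn (j + 1) u v
      have := hn j u (σ v)
      simp only [ParallelGreedy.stepMass]
      split_ifs <;> positivity
  · intro j u v hne
    by_cases hold : w j u v = 0
    · by_cases hv : σ v = v
      · rw [stepMass_of_fixed hv] at hne
        exact absurd hold hne
      cases j with
      | zero =>
        simp only [ParallelGreedy.stepMass, hv, hold] at hne
        have : u = v := by
          by_contra h
          simp [h] at hne
        simp [this]
      | succ j =>
        simp only [ParallelGreedy.stepMass, hv, hold] at hne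
        have hj : w j u (σ v) ≠ 0 := by
          intro h
          simp [h] at hne
        have h1 : H'.edist u (σ v) ≤ j := (SimpleGraph.edist_anti hle).trans (hw.edist_le _ _ _ hj)
        have h2 : H'.edist (σ v) v = 1 :=
          SimpleGraph.edist_eq_one_iff_adj.2 ((hH' v (σ v)).2 (.inr ⟨hv, rfl⟩)).symm
        calc H'.edist u v ≤ H'.edist u (σ v) + H'.edist (σ v) v := SimpleGraph.edist_triangle
          _ ≤ j + 1 := add_le_add h1 h2.le
          _ = _ := by push_cast; rfl
    · exact (SimpleGraph.edist_anti hle).trans (hw.edist_le _ _ _ hold)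
  · intro j hj u v
    by_cases hv : σ v = v
    · rw [stepMass_of_fixed hv]
      exact hw.le_pow j hj u v
    cases j with
    | zero =>
      -- walkers that were just reset are bounded by the unit total mass at `v`
      have hsum : (1 - p) * w 0 u v + p * ∑ a, w K a (σ v) ≤ 1 := by
        have h1 := hw.le_one (Nat.zero_le K) u v
        have h2 : ∑ a, w K a (σ v) ≤ 1 := by
          rw [← hw.total (σ v)]
          exact single_le_sum (f := fun i ↦ ∑ a, w i a (σ v))
            (fun i _ ↦ sum_nonneg fun a _ ↦ hw.nonneg i a _) (mem_range.2 (by omega))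
        nlinarith [mul_le_mul_of_nonneg_left h1 hq, mul_le_mul_of_nonneg_left h2 hp0]
      have hs : 0 ≤ p * ∑ a, w K a (σ v) := mul_nonneg hp0 (sum_nonneg fun a _ ↦ hw.nonneg K a _)
      simp only [ParallelGreedy.stepMass, hv, if_false, pow_zero]
      split_ifs <;> linarith
    | succ j =>
      have hjK : j ≤ K := by omega
      have hc : (if j < K then 1 - p else 1) * w (j + 1) u v ≤ w (j + 1) u v := by
        have := hw.nonneg (j + 1) u v
        split_ifs <;> nlinarith
      simp only [ParallelGreedy.stepMass, hv, if_false, hjK, if_true]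
      rcases hw.eq_zero_or_eq_zero hK (hun v hv) hjK u with h0 | h0
      · rw [h0, mul_zero, zero_add, pow_succ']
        exact mul_le_mul_of_nonneg_left (hw.le_pow j (by omega) u _) hp0
      · rw [h0, mul_zero, add_zero]
        exact hc.trans (hw.le_pow _ hj u v)
  · classical
    have hdeg (v : V) : ((H'.neighborSet v).ncard : ℝ) =
        (H.neighborSet v).ncard + if σ v = v then 0 else 1 := by
      split_ifs with hv
      · have : H'.neighborSet v = H.neighborSet v := by
          ext x
          simp [hH', hv]
        simp [this]
      · have : H'.neighborSet v = insert (σ v) (H.neighborSet v) := by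
          ext x
          simp [hH', hv, or_comm, eq_comm]
        rw [this, Set.ncard_insert_of_notMem]
        · push_cast; rfl
        · exact (hun v hv).not_adj ht
    have hmov (v : V) : ∑ j ∈ range (K + 2), (j : ℝ) * ∑ u, ParallelGreedy.stepMass p K σ w j u v =
        ∑ j ∈ range (K + 2), (j : ℝ) * ∑ u, w j u v + p * (if σ v = v then 0 else 1) +
        p * (∑ j ∈ range (K + 1), (j : ℝ) * ∑ u, w j u (σ v) -
          ∑ j ∈ range (K + 1), (j : ℝ) * ∑ u, w j u v) := by
      split_ifs with hv
      · simp only [stepMass_of_fixed hv, hv]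
        ring
      · rw [moves_stepMass hw.total hv, mul_one]
    simp only [hmov, hdeg, sum_add_distrib, mul_add, ← mul_sum, sum_sub_distrib]
    rw [Equiv.sum_comp σ fun v ↦ ∑ j ∈ range (K + 1), (j : ℝ) * ∑ u, w j u v, ← hw.moves]
    ring

end Step

/-- The initial state: one walker on each vertex. -/
lemma isWalkMass_bot [DecidableEq V] (hp0 : 0 ≤ p) :
    IsWalkMass p K (⊥ : SimpleGraph V) fun j u v ↦ if j = 0 ∧ u = v then 1 else 0 := by
  refine ⟨?_, ?_, ?_, ?_, ?_⟩
  · intro j u v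
    split_ifs <;> norm_num
  · intro j u v h
    have : j = 0 ∧ u = v := by
      by_contra hc
      simp [hc] at h
    simp [this]
  · intro j _ u v
    split_ifs with h
    · simp [h.1]
    · positivity
  · intro v
    rw [sum_range_succ']
    simp
  · simp [sum_range_succ' _ (K + 1)]

lemma IsReachable.exists_isWalkMass {t : ℝ} (ht : 1 ≤ t) (hK : 2 * K + 1 ≤ t) (hp0 : 0 ≤ p)
    (hp1 : p ≤ 1) {G H : SimpleGraph V} (h : IsReachable t G H) : ∃ w, IsWalkMass p K H w := by
  classical
  induction h with
  | refl => exact ⟨_, isWalkMass_bot hp0⟩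
  | tail _ hs ih =>
    obtain ⟨w, hw⟩ := ih
    obtain ⟨-, M, hM, -, hun, rfl⟩ := hs
    obtain ⟨σ, hσ⟩ := exists_perm_of_isMatching hM
    refine ⟨_, hw.stepMass hp0 hp1 ht hK (σ := σ) (fun v hv ↦ hun _ _ ((hσ _ _).2 ⟨hv, rfl⟩)) ?_⟩
    intro u v
    rw [← hσ]
    rfl

/-! ### The edge bound -/

lemma sum_ncard_neighborSet (H : SimpleGraph V) :
    ∑ v, ((H.neighborSet v).ncard : ℝ) = 2 * H.edgeSet.ncard := by
  classical
  have h := H.sum_degrees_eq_twice_card_edges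
  rw [← SimpleGraph.coe_edgeFinset, Set.ncard_coe_finset]
  have h2 (v : V) : (H.neighborSet v).ncard = H.degree v := by
    rw [Set.ncard_eq_toFinset_card', ← SimpleGraph.neighborFinset_def,
      SimpleGraph.card_neighborFinset_eq_degree]
  simp only [h2]
  exact_mod_cast h

/-- The two ways of counting moves: walkers since their last reset, and completed rounds. -/
lemma IsWalkMass.two_mul_ncard_edgeSet_le {H : SimpleGraph V} (hw : IsWalkMass p K H w) :
    p * (2 * H.edgeSet.ncard) ≤ Fintype.card V * K +
      Fintype.card V * ((K + 1) * (Fintype.card V * p ^ (K + 1))) := by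
  rw [← sum_ncard_neighborSet, hw.moves]
  have hv (v : V) : ∑ j ∈ range (K + 2), (j : ℝ) * ∑ u, w j u v ≤
      K + (K + 1) * (Fintype.card V * p ^ (K + 1)) := by
    rw [sum_range_succ]
    refine add_le_add ?_ ?_
    · calc ∑ j ∈ range (K + 1), (j : ℝ) * ∑ u, w j u v
          ≤ ∑ j ∈ range (K + 1), (K : ℝ) * ∑ u, w j u v := by
            refine sum_le_sum fun j hj ↦ ?_
            have : j ≤ K := by have := mem_range.1 hj; omega
            gcongr
            exact sum_nonneg fun u _ ↦ hw.nonneg j u v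
        _ = K := by rw [← mul_sum, hw.total, mul_one]
    · push_cast
      gcongr
      calc ∑ u, w (K + 1) u v ≤ ∑ _u : V, p ^ (K + 1) :=
            sum_le_sum fun u _ ↦ hw.le_pow _ le_rfl u v
        _ = _ := by simp
  refine (sum_le_sum fun v _ ↦ hv v).trans_eq ?_
  simp

/-- With `k = K + 1`, a graph built with threshold `t ≥ 2 * k - 1` has at most `k * n ^ (1 + 1 / k)`
edges. -/
lemma IsReachable.ncard_edgeSet_le [Nonempty V] {t : ℝ} (ht : 1 ≤ t) (hK : 2 * K + 1 ≤ t)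
    {G H : SimpleGraph V} (h : IsReachable t G H) :
    (H.edgeSet.ncard : ℝ) ≤ (K + 1) * (Fintype.card V : ℝ) ^ (1 + 1 / (K + 1 : ℝ)) := by
  set n : ℝ := (Fintype.card V : ℝ) with hn
  have hn1 : 1 ≤ n := by
    rw [hn]
    exact_mod_cast Fintype.card_pos (α := V)
  have hn0 : 0 < n := by linarith
  have hk : (0 : ℝ) < K + 1 := by positivity
  set q : ℝ := n ^ (1 / (K + 1 : ℝ)) with hq
  have hq1 : 1 ≤ q := Real.one_le_rpow hn1 (by positivity)
  have hqk : q ^ (K + 1) = n := by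
    rw [hq, ← Real.rpow_natCast, ← Real.rpow_mul hn0.le]
    push_cast
    rw [one_div_mul_cancel hk.ne', Real.rpow_one]
  -- `p = q⁻¹` balances the two terms: the expected number of resets becomes `n`
  obtain ⟨w, hw⟩ := h.exists_isWalkMass (p := q⁻¹) ht hK (by positivity) (inv_le_one_of_one_le₀ hq1)
  have hm := hw.two_mul_ncard_edgeSet_le
  rw [inv_pow, hqk, ← hn, mul_inv_cancel₀ hn0.ne', inv_mul_le_iff₀ (by linarith)] at hm
  rw [Real.rpow_add hn0, Real.rpow_one, ← hq]
  nlinarith [mul_pos hn0 (by linarith : 0 < q)]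

lemma IsReachable.ncard_edgeSet_le_log {t : ℝ} (ht : 1 ≤ t) {G H : SimpleGraph V}
    (h : IsReachable t G H) : (H.edgeSet.ncard : ℝ) ≤
      t ^ 3 * Real.log (Fintype.card V : ℝ) ^ 3 * (Fintype.card V : ℝ) ^ (1 + 7 / t) := by
  rcases le_or_gt (Fintype.card V) 1 with hn | hn
  · have : Subsingleton V := Fintype.card_le_one_iff_subsingleton.1 hn
    have hlog : Real.log (Fintype.card V : ℝ) = 0 := by
      interval_cases Fintype.card V <;> simp
    have hH : H = ⊥ := Subsingleton.elim _ _
    simp [hlog, hH]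
  have : Nonempty V := Fintype.card_pos_iff.1 (by omega)
  set n : ℝ := (Fintype.card V : ℝ) with hn'
  have hn2 : 2 ≤ n := by
    rw [hn']
    exact_mod_cast hn
  have hn0 : 0 < n := by linarith
  have hlog : (3 / 10 : ℝ) ≤ Real.log n ^ 3 := by
    have h1 := Real.log_le_log (by norm_num) hn2
    have h2 := Real.log_two_gt_d9
    calc (3 / 10 : ℝ) ≤ 0.69 ^ 3 := by norm_num
      _ ≤ _ := by gcongr; linarith
  have ht0 : 0 < t := by linarith
  rcases lt_or_ge t 2 with ht2 | ht2
  -- `k = 1`; the factor `n ^ (4 / t) ≥ 4` makes up for `log n ^ 3`, which is below `1` if `n = 2`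
  · have hm := h.ncard_edgeSet_le (K := 0) ht (by simpa using ht)
    have h4 : 4 ≤ n ^ (4 / t) := by
      calc (4 : ℝ) = 2 ^ (2 : ℝ) := by norm_num
        _ ≤ n ^ (2 : ℝ) := by gcongr
        _ ≤ n ^ (4 / t) := Real.rpow_le_rpow_of_exponent_le (by linarith)
            (by rw [le_div_iff₀ ht0]; linarith)
    have hexp : n ^ (1 + 7 / t) = n ^ (4 / t) * n ^ (1 + 3 / t) := by
      rw [← Real.rpow_add hn0]
      congr 1
      ring
    have hle : n ^ (1 + 1 / (((0 : ℕ) : ℝ) + 1)) ≤ n ^ (1 + 3 / t) := by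
      refine Real.rpow_le_rpow_of_exponent_le (by linarith) ?_
      have : 1 ≤ 3 / t := by
        rw [le_div_iff₀ ht0]
        linarith
      simpa using this
    have ht3 : 1 ≤ t ^ 3 := one_le_pow₀ ht
    have hprod : 1 ≤ t ^ 3 * Real.log n ^ 3 * n ^ (4 / t) := by
      calc (1 : ℝ) ≤ 1 * (3 / 10) * 4 := by norm_num
        _ ≤ _ := by gcongr
    calc (H.edgeSet.ncard : ℝ) ≤ 1 * n ^ (1 + 3 / t) := by
          refine hm.trans ?_
          simpa using hle
      _ ≤ t ^ 3 * Real.log n ^ 3 * n ^ (4 / t) * n ^ (1 + 3 / t) := by gcongr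
      _ = _ := by rw [hexp]; ring
  · have hfl := Nat.floor_le (show 0 ≤ (t - 1) / 2 by linarith)
    have hfl' := Nat.lt_floor_add_one ((t - 1) / 2)
    have hK1 : (1 : ℝ) ≤ (⌊(t - 1) / 2⌋₊ : ℝ) + 1 := by simp
    have hm := h.ncard_edgeSet_le (K := ⌊(t - 1) / 2⌋₊) ht (by linarith)
    set k : ℝ := (⌊(t - 1) / 2⌋₊ : ℝ) + 1 with hk
    have hkt : k ≤ t ^ 3 * Real.log n ^ 3 := by
      have h1 : t * 4 ≤ t ^ 3 := by nlinarith [mul_le_mul ht2 ht2 (by norm_num) ht0.le]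
      calc k ≤ t * 4 * (3 / 10) := by linarith
        _ ≤ _ := by gcongr
    refine hm.trans ?_
    have hexp : 1 + 1 / k ≤ 1 + 7 / t := by
      have : 1 / k ≤ 7 / t := by
        rw [div_le_div_iff₀ (by linarith) ht0]
        linarith
      linarith
    gcongr
    linarith

end ParallelGreedy

/-- Every execution of the parallel greedy algorithm terminates (there is no infinite execution,
and no execution gets stuck while the loop condition holds), and every output is a `t`-spanner
with at most `t ^ 3 * (log n) ^ 3 * n ^ (1 + C / t)` edges, with a universal constant `C`. -/
theorem mainTheorem1 :
    ∃ C : ℝ, 0 < C ∧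
      ∀ (V : Type*) [Fintype V] (G : SimpleGraph V) (t : ℝ), 1 ≤ t →
        (¬ ∃ F : ℕ → SimpleGraph V, F 0 = ⊥ ∧ ∀ i, ParallelGreedy.Step t G (F i) (F (i + 1))) ∧
        (∀ H : SimpleGraph V, ParallelGreedy.IsReachable t G H → ParallelGreedy.LoopGuard t G H →
          ∃ H' : SimpleGraph V, ParallelGreedy.Step t G H H') ∧
        (∀ H : SimpleGraph V, ParallelGreedy.IsOutput t G H →
          ParallelGreedy.IsSpanner t G H ∧
          (H.edgeSet.ncard : ℝ) ≤
            t ^ 3 * Real.log (Fintype.card V : ℝ) ^ 3 * (Fintype.card V : ℝ) ^ (1 + C / t)) := by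
  refine ⟨7, by norm_num, fun V _ G t ht ↦ ⟨ParallelGreedy.not_exists_infinite_run ht G,
    fun H _ hg ↦ hg.exists_step, fun H hH ↦ ⟨?_, ?_⟩⟩⟩
  · exact ParallelGreedy.isSpanner_of_not_loopGuard ht hH.1.le hH.2
  · exact hH.1.ncard_edgeSet_le_log ht
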